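/- Consider a caching system with $N\ge 1$ files $W_1,\dots,W_N$ of $F$ bits each and $K\ge 2$ users, where $N\le K$. A zero-error $(M,R)$ scheme for file size $F$ consists of: (i) for each user $k$, a cache of $\lfloor MF\rfloor$ bits, whose content is a function of the files only (not of the demands); (ii) for each demand vector $d\in\{1,\dots,N\}^K$ (files may be requested repeatedly or not at all), a common message of $\lfloor RF\rfloor$ bits that is a function of all the files; (iii) for each user $k$ and each demand vector $d$, a decoding function which, applied to the common message and the content of the cache of user $k$, returns $W_{d_k}$ for all possible contents of the files. Then for every $t=0,1,\dots,K$ the memory–rate pair $$(M,R)=\left(\frac{t[(N-1)t+K-N]}{K(K-1)},\ \frac{N(K-t)}{K}\right)$$ is achievable: there is an integer $B\ge1$ such that a zero-error $(M,R)$ scheme exists for every file size $F$ that is a multiple of $B$; and for every $\varepsilon>0$, a zero-error $(M+\varepsilon,R+\varepsilon)$ scheme exists for every sufficiently large file size $F$. -/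

import Mathlib

/-- Bit strings of length `n`. -/
abbrev Bits (n : ℕ) : Type := Fin n → Bool

/-- A caching scheme for `N` files of `F` bits each and `K` users, in which every user has a cache
of `c` bits and the server multicasts `r` bits. The caches are filled without knowledge of the
demands `d` (user `k` requests file `d k`); the common message depends on the demands and on all the
files; user `k` decodes from the demands, the common message and the content of its own cache. -/
structure CachingScheme (N K F c r : ℕ) where
  /-- content of the cache of each user, as a function of the files -/
  cache : Fin K → (Fin N → Bits F) → Bits c
  /-- common message sent to all the users, for each vector of demands -/
  transmit : (Fin K → Fin N) → (Fin N → Bits F) → Bits r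
  /-- decoder of each user, for each vector of demands -/
  decode : (Fin K → Fin N) → Fin K → Bits r → Bits c → Bits F

/-- For every vector of demands (files may be requested repeatedly or not at all) and all contents
of the files, every user recovers the file that it requests, without error. -/
def CachingScheme.IsCorrect {N K F c r : ℕ} (s : CachingScheme N K F c r) : Prop :=
  ∀ (d : Fin K → Fin N) (W : Fin N → Bits F) (k : Fin K),
    s.decode d k (s.transmit d W) (s.cache k W) = W (d k)

/-- Files of `F` bits can be served without error with caches of at most `M * F` bits and a
common message of at most `R * F` bits. -/
def ServesFileSize (N K : ℕ) (M R : ℝ) (F : ℕ) : Prop :=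
  ∃ s : CachingScheme N K F ⌊M * F⌋₊ ⌊R * F⌋₊, s.IsCorrect

/-- The pair `(M, R)` is achieved exactly: for all file sizes `F` that are multiples of some
positive block length, with no slack in the cache size or in the rate. -/
def ExactlyAchievable (N K : ℕ) (M R : ℝ) : Prop :=
  ∃ B : ℕ, 0 < B ∧ ∀ F : ℕ, B ∣ F → ServesFileSize N K M R F

/-- The pair `(M, R)` is achieved in the limit: for every `ε > 0`, all sufficiently large
file sizes `F` are served with cache size `M + ε` and rate `R + ε` (in multiples of `F`). -/
def AsymptoticallyAchievable (N K : ℕ) (M R : ℝ) : Prop :=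
  ∀ ε : ℝ, 0 < ε → ∀ᶠ F : ℕ in Filter.atTop, ServesFileSize N K (M + ε) (R + ε) F

/-!
The scheme is linear over a field `L` with `2 ^ a` elements. A file consists of `C(K, t)` symbols of
`L`, labelled by the `t`-subsets `S` of the set of users; longer files are cut into blocks.
User `k` does not cache the symbols whose label contains `k`, but only as many generic linear
combinations of them (over all files) as are needed on top of what the message will reveal.

*Message.* Each file `n` gets a leader `u n` (`exists_leaders`): distinct files have distinct
leaders, and the leader of a requested file requests it. There is one slot `(n, S)` for each file `n`
and each `t`-set `S` with `u n ∉ S`, hence `N * C(K - 1, t)` slots, which is the rate.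
If `n` is requested, the slot carries the symbol `(n, S)` plus the sum of the symbols
`(n, S - i + u n)` over the users `i ∈ S` in the group of `n`. If `n` is not requested, its leader
wants another file `m`; the slot carries `(m, S)` or `(n, S)`, where `(m, S)` is chosen if `u m ∈ S`
and no earlier unrequested file has already sent it (`delivered`, `Relays`).

*Interference elimination.* For every user `k` there is a single skipped file such that each slot
`(n, S)` of another file with `k ∈ S` only involves symbols whose label contains `k`
(`delivered_restrictTo`). These combinations are independent, since one can choose a pivot in each
(`pivot_injective`), so at most `N * C(K - 1, t - 1) - (N - 1) * C(K - 2, t - 1)` dimensions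
remain hidden from `k` (`finrank_hiddenSubmodule_le`), which is the size of the cache. Over a large field one
linear map is injective on all the hidden subspaces, for all demands and all users
(`exists_linearMap_injOn_submodules`), so user `k` recovers all symbols whose label contains `k`.

*Decoding.* Given these, user `k` solves for the remaining symbols of its file `m`: first those
whose label contains `u m`, and from them the others (`eq_zero_of_delivered_eq_zero`).

As all maps are linear, injectivity is checked on kernels, and decoders need not be written down
(`servesFileSize_of_determines`).
-/

/-! ### Schemes over arbitrary alphabets -/

theorem nonempty_embedding_bits {A : Type*} [Fintype A] {m n : ℕ} (hA : Fintype.card A ≤ 2 ^ m)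
    (hmn : m ≤ n) : Nonempty (A ↪ Bits n) :=
  Function.Embedding.nonempty_of_card_le (by
    simpa [Bits] using hA.trans (Nat.pow_le_pow_right two_pos hmn))

/-- It suffices to describe a scheme over arbitrary finite alphabets, and to check that the message
and the cache of a user determine its file; the decoder is then obtained by choice. -/
theorem servesFileSize_of_determines {N K F c r : ℕ} {M R : ℝ} (hc : c ≤ ⌊M * F⌋₊)
    (hr : r ≤ ⌊R * F⌋₊) {X Y : Type*} {Z : (Fin K → Fin N) → Type*} [Fintype Y]
    [∀ d, Fintype (Z d)] (file : Bits F → X) (hfile : Function.Injective file)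
    (cache : Fin K → (Fin N → X) → Y) (transmit : ∀ d, (Fin N → X) → Z d)
    (hY : Fintype.card Y ≤ 2 ^ c) (hZ : ∀ d, Fintype.card (Z d) ≤ 2 ^ r)
    (determines : ∀ d k W W', transmit d W = transmit d W' → cache k W = cache k W' →
      W (d k) = W' (d k)) :
    ServesFileSize N K M R F := by
  classical
  obtain ⟨eY⟩ := nonempty_embedding_bits hY hc
  let eZ := fun d => (nonempty_embedding_bits (hZ d) hr).some
  let C : Fin K → (Fin N → Bits F) → Bits _ := fun k W => eY (cache k fun n => file (W n))
  let T : (Fin K → Fin N) → (Fin N → Bits F) → Bits _ :=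
    fun d W => eZ d (transmit d fun n => file (W n))
  refine ⟨⟨C, T, fun d k y z => if h : ∃ W, T d W = y ∧ C k W = z then h.choose (d k) else
    fun _ => false⟩, fun d W k => ?_⟩
  have h : ∃ W', T d W' = T d W ∧ C k W' = C k W := ⟨W, rfl, rfl⟩
  change (if h : ∃ W', T d W' = T d W ∧ C k W' = C k W then h.choose (d k) else
    fun _ => false) = W (d k)
  rw [dif_pos h]
  exact hfile (determines d k _ _ ((eZ d).injective h.choose_spec.1)
    (eY.injective h.choose_spec.2))

/-- Shorter files can be padded, so a scheme without slack for every multiple of the block length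
gives a scheme with slack for every large file size. -/
theorem ExactlyAchievable.asymptoticallyAchievable {N K : ℕ} {M R : ℝ} (hM : 0 ≤ M) (hR : 0 ≤ R)
    (h : ExactlyAchievable N K M R) : AsymptoticallyAchievable N K M R := by
  obtain ⟨B, hB, h⟩ := h
  intro ε hε
  filter_upwards [Filter.eventually_ge_atTop ⌈(M + R) * B / ε⌉₊] with F hF
  have hF' : (M + R) * B ≤ ε * F := by
    rw [← div_le_iff₀' hε]; exact Nat.ceil_le.1 hF
  -- the least multiple of `B` above `F`, up to at most one block
  set G := B * (F / B + 1) with hG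
  have hFG : F ≤ G := by
    rw [hG, mul_add, mul_one, mul_comm B]; exact (Nat.lt_div_mul_add hB).le
  have hGF : (G : ℝ) ≤ F + B := by
    have : G ≤ F + B := by rw [hG, mul_add, mul_one]; gcongr; exact Nat.mul_div_le F B
    exact_mod_cast this
  obtain ⟨s, hs⟩ := h G (Dvd.intro _ rfl)
  have slack {x : ℝ} (hx : 0 ≤ x) (hxM : x ≤ M + R) : ⌊x * G⌋₊ ≤ ⌊(x + ε) * F⌋₊ := by
    apply Nat.floor_le_floor
    have := mul_le_mul_of_nonneg_left hGF hx
    have := mul_le_mul_of_nonneg_right hxM (Nat.cast_nonneg (α := ℝ) B)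
    linarith
  refine servesFileSize_of_determines (slack hM (by linarith)) (slack hR (by linarith))
    (Z := fun _ => Bits ⌊R * G⌋₊)
    (fun w (i : Fin G) => if hi : (i : ℕ) < F then w ⟨i, hi⟩ else false) (fun w w' hw => ?_)
    s.cache s.transmit (by simp [Bits]) (by simp [Bits]) (fun d k W W' ht hc => ?_)
  · funext i
    simpa using congrFun hw (Fin.castLE hFG i)
  · rw [← hs d W k, ← hs d W' k, ht, hc]

/-! ### Linear maps in general position -/

/-- Over a large enough field, a single linear map into a `c`-dimensional space is injective on each
of finitely many subspaces of dimension at most `c`. This plays the role of a rank metric code. -/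
theorem exists_linearMap_injOn_submodules {L V ι : Type*} [Field L] [AddCommGroup V] [Module L V]
    [FiniteDimensional L V] [Fintype ι] (hL : Fintype.card ι < Nat.card L) [Finite L] (c : ℕ)
    (Z : ι → Submodule L V) (hZ : ∀ i, Module.finrank L (Z i) ≤ c) :
    ∃ Φ : V →ₗ[L] (Fin c → L), ∀ i, ∀ x ∈ Z i, Φ x = 0 → x = 0 := by
  classical
  induction c generalizing Z with
  | zero =>
    refine ⟨0, fun i x hx _ => ?_⟩
    simpa [Submodule.finrank_eq_zero.1 (Nat.le_zero.1 (hZ i))] using hx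
  | succ c ih =>
    -- a functional that is nonzero on every nonzero subspace of the family
    have hφ : ∃ φ : Module.Dual L V, ∀ i, Z i ≠ ⊥ → ∃ z ∈ Z i, φ z ≠ 0 := by
      let s : Finset ι := Finset.univ.filter fun i => Z i ≠ ⊥
      let q : s → Submodule L (Module.Dual L V) := fun i => (Z i).dualAnnihilator
      have hq : ∀ i, q i ≠ ⊤ := by
        rintro ⟨i, hi⟩ h
        have hi' : Z i ≠ ⊥ := by simpa [s] using hi
        apply hi'
        rw [eq_bot_iff]
        intro z hz
        rw [Submodule.mem_bot, ← Module.forall_dual_apply_eq_zero_iff L]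
        intro φ
        have : φ ∈ q ⟨i, hi⟩ := h ▸ Submodule.mem_top
        exact (Submodule.mem_dualAnnihilator φ).1 this z hz
      have hcard : ((Finset.univ : Finset s).card : ℕ∞) < ENat.card L := by
        rw [ENat.card_eq_coe_natCard]
        have : (Finset.univ : Finset s).card ≤ Fintype.card ι := by
          rw [Finset.card_univ, Fintype.card_coe]; exact Finset.card_le_univ s
        exact_mod_cast this.trans_lt hL
      obtain ⟨φ, -, hφ⟩ := Set.exists_of_ssubset
        (Submodule.iUnion_ssubset_of_forall_ne_top_of_card_lt Finset.univ q hq hcard)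
      refine ⟨φ, fun i hi => ?_⟩
      by_contra! hcon
      apply hφ
      simp only [Set.mem_iUnion]
      exact ⟨⟨i, by simpa [s] using hi⟩, Finset.mem_univ _,
        (Submodule.mem_dualAnnihilator φ).2 hcon⟩
    obtain ⟨φ, hφ⟩ := hφ
    obtain ⟨Φ, hΦ⟩ := ih (fun i => Z i ⊓ LinearMap.ker φ) fun i => by
      by_cases hi : Z i = ⊥
      · rw [show Z i ⊓ LinearMap.ker φ = ⊥ by rw [hi, bot_inf_eq], finrank_bot]; exact Nat.zero_le c
      · obtain ⟨z, hz, hφz⟩ := hφ i hi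
        have : Z i ⊓ LinearMap.ker φ < Z i :=
          lt_of_le_of_ne inf_le_left fun h => hφz (by rw [← h] at hz; exact hz.2)
        have := Submodule.finrank_lt_finrank_of_lt this
        have := hZ i
        omega
    refine ⟨LinearMap.pi (Fin.cons φ fun j => LinearMap.proj j ∘ₗ Φ), fun i x hx h => ?_⟩
    have h0 : φ x = 0 := by simpa using congrFun h 0
    refine hΦ i x ⟨hx, h0⟩ (funext fun j => ?_)
    simpa using congrFun h j.succ

/-! ### Leaders -/

/-- Every file can be given a leader, distinct files having distinct leaders, such that the leader
of a requested file requests it. -/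
theorem exists_leaders {N K : ℕ} (hNK : N ≤ K) (d : Fin K → Fin N) :
    ∃ u : Fin N → Fin K, Function.Injective u ∧ ∀ k, d (u (d k)) = d k := by
  classical
  choose g hg using fun n : Set.range d => n.2
  have hgi : Function.Injective g := fun a b h => Subtype.ext (by rw [← hg a, ← hg b, h])
  have hcard : Fintype.card ↥(Set.range d)ᶜ ≤ Fintype.card ↥(Set.range g)ᶜ := by
    rw [Fintype.card_compl_set, Fintype.card_compl_set, Set.card_range_of_injective hgi]
    simpa using Nat.sub_le_sub_right hNK _
  obtain ⟨e⟩ := Function.Embedding.nonempty_of_card_le hcard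
  refine ⟨fun n => if h : n ∈ Set.range d then g ⟨n, h⟩ else e ⟨n, h⟩, fun a b hab => ?_,
    fun k => ?_⟩
  · by_cases ha : a ∈ Set.range d <;> by_cases hb : b ∈ Set.range d <;>
      simp only [ha, hb, dite_true, dite_false] at hab
    · simpa using hgi hab
    · exact absurd ⟨_, hab⟩ (e ⟨b, hb⟩).2
    · exact absurd ⟨_, hab.symm⟩ (e ⟨a, ha⟩).2
    · simpa using e.injective (Subtype.ext hab)
  · simpa using hg ⟨d k, Set.mem_range_self k⟩

/-! ### Counting subsets -/

theorem card_filter_notMem {K : ℕ} (t : ℕ) (s : Finset (Fin K)) :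
    (Finset.univ.filter fun S : Finset (Fin K) => S.card = t ∧ ∀ i ∈ s, i ∉ S).card =
      (K - s.card).choose t := by
  classical
  have : (Finset.univ.filter fun S : Finset (Fin K) => S.card = t ∧ ∀ i ∈ s, i ∉ S) =
      sᶜ.powersetCard t := by
    ext S
    simp only [Finset.mem_filter, Finset.mem_univ, true_and, Finset.mem_powersetCard,
      Finset.subset_iff, Finset.mem_compl]
    exact ⟨fun h => ⟨fun i hi his => h.2 i his hi, h.1⟩, fun h => ⟨h.2, fun i his hi => h.1 hi his⟩⟩
  rw [this, Finset.card_powersetCard, Finset.card_compl, Fintype.card_fin]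

theorem card_filter_mem {K : ℕ} (t : ℕ) (k : Fin K) :
    (Finset.univ.filter fun S : Finset (Fin K) => S.card = t ∧ k ∈ S).card =
      K.choose t - (K - 1).choose t := by
  have h0 := card_filter_notMem (K := K) t ∅
  have h1 := card_filter_notMem t {k}
  simp only [Finset.notMem_empty, false_imp_iff, implies_true, and_true, Finset.card_empty,
    Nat.sub_zero, Finset.mem_singleton, forall_eq, Finset.card_singleton] at h0 h1
  rw [← h0, ← h1, ← Finset.card_filter_add_card_filter_not
    (s := Finset.univ.filter fun S : Finset (Fin K) => S.card = t) (fun S => k ∈ S)]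
  simp only [Finset.filter_filter, add_tsub_cancel_right]

theorem card_filter_notMem_mem {K : ℕ} (t : ℕ) {v k : Fin K} (hvk : v ≠ k) :
    (Finset.univ.filter fun S : Finset (Fin K) => S.card = t ∧ v ∉ S ∧ k ∈ S).card =
      (K - 1).choose t - (K - 2).choose t := by
  have h1 := card_filter_notMem t {v}
  have h2 := card_filter_notMem t {v, k}
  simp only [Finset.mem_insert, Finset.mem_singleton, forall_eq, Finset.card_singleton,
    forall_eq_or_imp, Finset.card_pair hvk] at h1 h2
  rw [← h1, ← h2, ← Finset.card_filter_add_card_filter_not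
    (s := Finset.univ.filter fun S : Finset (Fin K) => S.card = t ∧ v ∉ S) (fun S => k ∈ S)]
  simp only [Finset.filter_filter, and_assoc, add_tsub_cancel_right]

theorem cast_choose_pred_mul (n t : ℕ) :
    ((n.choose t : ℕ) : ℝ) * (n + 1) = (n + 1).choose t * (n + 1 - t) := by
  have h := Nat.choose_mul_succ_eq n t
  rcases le_or_gt t (n + 1) with ht | ht
  · have : (((n + 1 - t : ℕ)) : ℝ) = n + 1 - t := by push_cast [Nat.cast_sub ht]; ring
    rw [← this]
    exact_mod_cast h
  · rw [Nat.choose_eq_zero_of_lt ht, Nat.choose_eq_zero_of_lt (by omega)]; simp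

/-! ### The delivered combinations -/

section Delivery

variable {N K : ℕ} {L : Type*} [Field L]

/-- With demands `d` and leaders `u`, user `i` belongs to the group of file `n`: it requests `n` and
is not the leader of another file. The group of a file that nobody requests is empty. -/
def InGroup (d : Fin K → Fin N) (u : Fin N → Fin K) (n : Fin N) (i : Fin K) : Prop :=
  d i = n ∧ ∀ n', u n' = i → n' = n

/-- For a file `n` that nobody requests, the condition on `S` under which the slot `(n, S)` of the
message carries a symbol of the file `d (u n)` requested by the leader of `n`, rather than of `n`.
Minimality of `n` makes sure that no symbol is sent in two slots. -/
def Relays (d : Fin K → Fin N) (u : Fin N → Fin K) (n : Fin N) (S : Finset (Fin K)) : Prop :=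
  u (d (u n)) ∈ S ∧ ∀ n' < n, d (u n') ≠ n' → d (u n') = d (u n) → u n' ∈ S

open Classical in
/-- The content of the slot `(n, S)` of the message, where `u n ∉ S`, as a linear form in the symbols
of all the files; the symbol `(n, S)` is the part of file `n` labelled by the set `S` of users.
The case `d (u n) = n` is that of a requested file. -/
noncomputable def delivered (L : Type*) [Field L] (d : Fin K → Fin N) (u : Fin N → Fin K)
    (n : Fin N) (S : Finset (Fin K)) : (Fin N × Finset (Fin K) → L) →ₗ[L] L :=
  if d (u n) = n then
    LinearMap.proj (n, S) +
      ∑ i ∈ S.filter (InGroup d u n), LinearMap.proj (n, insert (u n) (S.erase i))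
  else if Relays d u n S then LinearMap.proj (d (u n), S) else LinearMap.proj (n, S)

open Classical in
theorem delivered_of_requested {d : Fin K → Fin N} {u : Fin N → Fin K} {n : Fin N}
    (h : d (u n) = n) (S : Finset (Fin K)) (x : Fin N × Finset (Fin K) → L) :
    delivered L d u n S x =
      x (n, S) + ∑ i ∈ S.filter (InGroup d u n), x (n, insert (u n) (S.erase i)) := by
  simp [delivered, h, LinearMap.sum_apply]

open Classical in
/-- The file whose slots are of no use to user `k` for interference elimination: the file led by
`k`, or else the file requested by `k`. -/
noncomputable def skippedFile (d : Fin K → Fin N) (u : Fin N → Fin K) (k : Fin K) : Fin N :=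
  if h : ∃ n, u n = k then h.choose else d k

variable {d : Fin K → Fin N} {u : Fin N → Fin K}

theorem skippedFile_leader (hu : Function.Injective u) (n : Fin N) :
    skippedFile d u (u n) = n := by
  have h : ∃ n', u n' = u n := ⟨n, rfl⟩
  rw [skippedFile, dif_pos h]
  exact hu h.choose_spec

theorem InGroup.skippedFile_eq {n : Fin N} {k : Fin K} (h : InGroup d u n k) :
    skippedFile d u k = n := by
  rw [skippedFile]
  split_ifs with hk
  · exact h.2 _ hk.choose_spec
  · exact h.1

theorem card_insert_erase {S : Finset (Fin K)} {v i : Fin K} (hv : v ∉ S) (hi : i ∈ S) :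
    (insert v (S.erase i)).card = S.card := by
  rw [Finset.card_insert_of_notMem (fun h => hv (Finset.mem_of_mem_erase h)),
    Finset.card_erase_add_one hi]

/-- The restriction of the symbols to those labelled by sets containing `k`. -/
noncomputable def restrictTo (L : Type*) [Field L] (N : ℕ) (k : Fin K) :
    (Fin N × Finset (Fin K) → L) →ₗ[L] (Fin N × Finset (Fin K) → L) :=
  LinearMap.pi fun p => if k ∈ p.2 then LinearMap.proj p else 0

theorem restrictTo_apply (k : Fin K) (x : Fin N × Finset (Fin K) → L)
    (p : Fin N × Finset (Fin K)) : restrictTo L N k x p = if k ∈ p.2 then x p else 0 := by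
  simp only [restrictTo, LinearMap.pi_apply]
  split_ifs <;> simp

/-- A slot `(n, S)` with `k ∈ S`, of a file that `k` does not skip, only involves symbols labelled
by sets containing `k`. -/
theorem delivered_restrictTo {k : Fin K} {n : Fin N} {S : Finset (Fin K)}
    (hn : n ≠ skippedFile d u k) (hk : k ∈ S) (x : Fin N × Finset (Fin K) → L) :
    delivered L d u n S (restrictTo L N k x) = delivered L d u n S x := by
  classical
  by_cases h : d (u n) = n
  · rw [delivered_of_requested h, delivered_of_requested h, restrictTo_apply, if_pos hk]
    congr 1
    refine Finset.sum_congr rfl fun i hi => ?_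
    rw [restrictTo_apply, if_pos]
    refine Finset.mem_insert_of_mem (Finset.mem_erase.2 ⟨?_, hk⟩)
    rintro rfl
    exact hn (Finset.mem_filter.1 hi).2.skippedFile_eq.symm
  · simp only [delivered, h, if_false]
    split_ifs <;> simp [restrictTo_apply, hk]

/-- The vectors of symbols labelled by `t`-sets containing `k` on which all the slots of use to
user `k` for interference elimination vanish. -/
def hiddenSubmodule (L : Type*) [Field L] (t : ℕ) (d : Fin K → Fin N) (u : Fin N → Fin K)
    (k : Fin K) : Submodule L (Fin N × Finset (Fin K) → L) where
  carrier := {x | (∀ p : Fin N × Finset (Fin K), ¬ (p.2.card = t ∧ k ∈ p.2) → x p = 0) ∧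
    ∀ n S, n ≠ skippedFile d u k → S.card = t → u n ∉ S → k ∈ S → delivered L d u n S x = 0}
  add_mem' := fun {x y} hx hy =>
    ⟨fun p hp => by simp [hx.1 p hp, hy.1 p hp], fun n S h1 h2 h3 h4 => by
      rw [map_add, hx.2 n S h1 h2 h3 h4, hy.2 n S h1 h2 h3 h4, add_zero]⟩
  zero_mem' := ⟨fun _ _ => rfl, fun _ _ _ _ _ _ => map_zero _⟩
  smul_mem' := fun a x hx =>
    ⟨fun p hp => by simp [hx.1 p hp], fun n S h1 h2 h3 h4 => by
      rw [map_smul, hx.2 n S h1 h2 h3 h4, smul_zero]⟩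

open Classical in
/-- A symbol occurring in the slot `(n, S)`, chosen so that distinct slots have distinct pivots. -/
noncomputable def pivot (d : Fin K → Fin N) (u : Fin N → Fin K) (n : Fin N)
    (S : Finset (Fin K)) : Fin N × Finset (Fin K) :=
  if d (u n) ≠ n ∧ Relays d u n S then (d (u n), S) else (n, S)

theorem delivered_of_not_requested {n : Fin N} (h : d (u n) ≠ n) (S : Finset (Fin K))
    (x : Fin N × Finset (Fin K) → L) : delivered L d u n S x = x (pivot d u n S) := by
  simp only [delivered, pivot, h, if_false, ne_eq, not_false_eq_true, true_and]
  split_ifs <;> simp_all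

theorem pivot_snd (n : Fin N) (S : Finset (Fin K)) : (pivot d u n S).2 = S := by
  unfold pivot
  split_ifs <;> rfl

theorem pivot_injective {n n' : Fin N} {S S' : Finset (Fin K)}
    (hn : u n ∉ S) (hn' : u n' ∉ S') (h : pivot d u n S = pivot d u n' S') :
    n = n' ∧ S = S' := by
  obtain rfl : S = S' := by simpa only [pivot_snd] using congrArg Prod.snd h
  refine ⟨?_, rfl⟩
  unfold pivot at h
  split_ifs at h with h1 h2 h2 <;> simp only [Prod.mk.injEq, and_true] at h
  · rcases lt_trichotomy n n' with hlt | heq | hgt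
    · exact absurd (h2.2.2 n hlt h1.1 h) hn
    · exact heq
    · exact absurd (h1.2.2 n' hgt h2.1 h.symm) hn'
  · exact absurd (h ▸ h1.2.1) hn'
  · exact absurd (h ▸ h2.2.1) hn
  · exact h

/-- Eliminating the pivots: user `k` sees `C(K - 2, t - 1)` independent combinations of its symbols
for each of the `N - 1` files that it does not skip. -/
theorem finrank_hiddenSubmodule_le (t : ℕ) (hu : Function.Injective u) (k : Fin K) :
    Module.finrank L (hiddenSubmodule L t d u k) ≤
      N * (K.choose t - (K - 1).choose t) -
        (N - 1) * ((K - 1).choose t - (K - 2).choose t) := by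
  classical
  let C : Finset (Fin N × Finset (Fin K)) :=
    Finset.univ ×ˢ Finset.univ.filter fun S => S.card = t ∧ k ∈ S
  let E : Finset (Σ _ : Fin N, Finset (Fin K)) :=
    (Finset.univ.erase (skippedFile d u k)).sigma fun n =>
      Finset.univ.filter fun S => S.card = t ∧ u n ∉ S ∧ k ∈ S
  let P := E.image fun e => pivot d u e.1 e.2
  have memE {n S} : (⟨n, S⟩ : Σ _ : Fin N, Finset (Fin K)) ∈ E ↔
      n ≠ skippedFile d u k ∧ S.card = t ∧ u n ∉ S ∧ k ∈ S := by simp [E]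
  have hC : C.card = N * (K.choose t - (K - 1).choose t) := by
    rw [Finset.card_product, card_filter_mem, Finset.card_univ, Fintype.card_fin]
  have hE : E.card = (N - 1) * ((K - 1).choose t - (K - 2).choose t) := by
    rw [Finset.card_sigma, Finset.sum_congr rfl fun n hn => card_filter_notMem_mem t (k := k) ?_]
    · simp
    · rintro rfl
      exact (Finset.mem_erase.1 hn).1 (skippedFile_leader hu n).symm
  have hPC : P ⊆ C := by
    intro p hp
    obtain ⟨⟨n, S⟩, he, rfl⟩ := Finset.mem_image.1 hp
    simp only [C, Finset.mem_product, Finset.mem_univ, true_and, Finset.mem_filter, pivot_snd]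
    exact ⟨(memE.1 he).2.1, (memE.1 he).2.2.2⟩
  have hP : P.card = E.card := by
    refine Finset.card_image_of_injOn ?_
    rintro ⟨n, S⟩ he ⟨n', S'⟩ he' h
    obtain ⟨rfl, rfl⟩ := pivot_injective (memE.1 he).2.2.1 (memE.1 he').2.2.1 h
    rfl
  let ρ : hiddenSubmodule L t d u k →ₗ[L] ((C \ P : Finset _) → L) :=
    LinearMap.pi fun p => LinearMap.proj p.1 ∘ₗ (hiddenSubmodule L t d u k).subtype
  have hρ : Function.Injective ρ := by
    rw [injective_iff_map_eq_zero]
    rintro ⟨x, hx⟩ hx0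
    have nonpivot : ∀ p ∉ P, x p = 0 := by
      intro p hp
      by_cases hpC : p ∈ C
      · exact congrFun hx0 ⟨p, Finset.mem_sdiff.2 ⟨hpC, hp⟩⟩
      · exact hx.1 p (by simpa [C] using hpC)
    have unrequested : ∀ n S, (⟨n, S⟩ : Σ _ : Fin N, Finset (Fin K)) ∈ E → d (u n) ≠ n →
        x (pivot d u n S) = 0 := by
      intro n S he hn
      have := memE.1 he
      rw [← delivered_of_not_requested hn S x]
      exact hx.2 n S this.1 this.2.1 this.2.2.1 this.2.2.2
    have pivotRequested {n : Fin N} {S : Finset (Fin K)} (hn : d (u n) = n) :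
        pivot d u n S = (n, S) := if_neg fun h => h.1 hn
    have key : ∀ p, x p = 0 := by
      intro p
      by_cases hp : p ∈ P
      · obtain ⟨⟨n, S⟩, he, rfl⟩ := Finset.mem_image.1 hp
        by_cases hn : d (u n) = n
        · obtain ⟨h1, h2, h3, h4⟩ := memE.1 he
          have h := hx.2 n S h1 h2 h3 h4
          rw [delivered_of_requested hn, Finset.sum_eq_zero, add_zero] at h
          · rwa [pivotRequested hn]
          · intro i _
            -- this symbol contains `u n`, so it can only be the pivot of an unrequested file
            by_cases hq : (n, insert (u n) (S.erase i)) ∈ P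
            · obtain ⟨⟨n', S'⟩, he', hq'⟩ := Finset.mem_image.1 hq
              by_cases hn' : d (u n') = n'
              · simp only [pivotRequested hn', Prod.mk.injEq] at hq'
                obtain ⟨rfl, rfl⟩ := hq'
                exact absurd (Finset.mem_insert_self _ _) (memE.1 he').2.2.1
              · rw [← hq']
                exact unrequested n' S' he' hn'
            · exact nonpivot _ hq
        · exact unrequested n S he hn
      · exact nonpivot p hp
    exact Subtype.ext (funext key)
  have := LinearMap.finrank_le_finrank_of_injective hρ
  rwa [Module.finrank_fintype_fun_eq_card, Fintype.card_coe, Finset.card_sdiff_of_subset hPC, hP,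
    hC, hE] at this

/-- Once the symbols labelled by sets containing `k` are known, the message determines the file
requested by user `k`. -/
theorem eq_zero_of_delivered_eq_zero {t : ℕ} (hd : ∀ k, d (u (d k)) = d k) (k : Fin K)
    {x : Fin N × Finset (Fin K) → L}
    (hx : ∀ n S, S.card = t → u n ∉ S → delivered L d u n S x = 0)
    (hk : ∀ n S, S.card = t → k ∈ S → x (n, S) = 0) (S : Finset (Fin K)) (hS : S.card = t) :
    x (d k, S) = 0 := by
  classical
  have hm := hd k
  have leader : ∀ S : Finset (Fin K), S.card = t → u (d k) ∈ S → x (d k, S) = 0 := by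
    intro S hS huS
    by_cases hkS : k ∈ S
    · exact hk _ _ hS hkS
    by_cases hg : ∃ n, u n = k ∧ n ≠ d k
    · -- `k` leads an unrequested file, so a slot of some unrequested file carries `(d k, S)`
      obtain ⟨n₀, rfl, hn₀⟩ := hg
      have hex : ∃ n, d (u n) ≠ n ∧ d (u n) = d (u n₀) ∧ u n ∉ S := ⟨n₀, hn₀.symm, rfl, hkS⟩
      obtain ⟨n, ⟨h1, h2, h3⟩, hmin⟩ := WellFounded.has_min
        (wellFounded_lt (α := Fin N)) {n | d (u n) ≠ n ∧ d (u n) = d (u n₀) ∧ u n ∉ S} hex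
      have hr : Relays d u n S := by
        refine ⟨by rwa [h2], fun n' hlt h4 h5 => ?_⟩
        by_contra h6
        exact hmin n' ⟨h4, h5.trans h2, h6⟩ hlt
      have := hx n S hS h3
      rwa [delivered_of_not_requested h1, pivot, if_pos ⟨h1, hr⟩, h2] at this
    · -- `k` is in the group of its file: swap `k` for the leader and isolate the symbol
      have hgk : InGroup d u (d k) k := ⟨rfl, fun n hn => by_contra fun h => hg ⟨n, hn, h⟩⟩
      have huk : u (d k) ≠ k := fun h => hkS (h ▸ huS)
      set A := insert k (S.erase (u (d k))) with hA
      have hAt : A.card = t := (card_insert_erase hkS huS).trans hS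
      have huA : u (d k) ∉ A := by simp [hA, huk]
      have hkA : k ∈ A := Finset.mem_insert_self _ _
      have h := hx (d k) A hAt huA
      rw [delivered_of_requested hm, hk _ _ hAt hkA, zero_add, Finset.sum_eq_single k] at h
      · rwa [hA, Finset.erase_insert (by simp [hkS]), Finset.insert_erase huS] at h
      · intro i hi hik
        have hiA := (Finset.mem_filter.1 hi).1
        exact hk _ _ ((card_insert_erase huA hiA).trans hAt)
          (Finset.mem_insert_of_mem (Finset.mem_erase.2 ⟨hik.symm, hkA⟩))
      · intro h'
        exact absurd (Finset.mem_filter.2 ⟨hkA, hgk⟩) h'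
  by_cases huS : u (d k) ∈ S
  · exact leader S hS huS
  · have h := hx (d k) S hS huS
    rwa [delivered_of_requested hm, Finset.sum_eq_zero, add_zero] at h
    intro i hi
    exact leader _ ((card_insert_erase huS (Finset.mem_filter.1 hi).1).trans hS)
      (Finset.mem_insert_self _ _)

end Delivery

/-! ### Parameters of the scheme -/

/-- The size of a cache in symbols, for files of `C(K, t)` symbols. -/
def cacheSymbols (N K t : ℕ) : ℕ :=
  N * (K.choose t - (K - 1).choose t) - (N - 1) * ((K - 1).choose t - (K - 2).choose t)

theorem cast_choose_pred {K : ℕ} (hK : 1 ≤ K) (t : ℕ) :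
    ((K - 1).choose t : ℝ) = K.choose t * (K - t) / K := by
  obtain ⟨k, rfl⟩ := Nat.exists_eq_add_of_le' hK
  rw [eq_div_iff (by positivity)]
  simpa using cast_choose_pred_mul k t

theorem cast_cacheSymbols {N K : ℕ} (hN : 1 ≤ N) (hK : 2 ≤ K) (t : ℕ) :
    (cacheSymbols N K t : ℝ) =
      (t : ℝ) * (((N : ℝ) - 1) * t + K - N) / ((K : ℝ) * ((K : ℝ) - 1)) * K.choose t := by
  have h1 : (K - 1).choose t ≤ K.choose t := Nat.choose_le_choose t (Nat.sub_le K 1)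
  have h2 : (K - 2).choose t ≤ (K - 1).choose t := Nat.choose_le_choose t (by omega)
  have h3 : (K - 1).choose t - (K - 2).choose t ≤ K.choose t - (K - 1).choose t := by
    obtain ⟨k, rfl⟩ := Nat.exists_eq_add_of_le' hK
    cases t with
    | zero => simp
    | succ s =>
      have e1 : (k + 2).choose (s + 1) = (k + 1).choose s + (k + 1).choose (s + 1) := rfl
      have e2 : (k + 1).choose (s + 1) = k.choose s + k.choose (s + 1) := rfl
      have e3 : k.choose s ≤ (k + 1).choose s := Nat.choose_le_choose s (Nat.le_succ k)
      simp only [Nat.add_sub_cancel, show k + 2 - 1 = k + 1 from rfl]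
      omega
  have hK' : ((K - 1 : ℕ) : ℝ) = K - 1 := by push_cast [Nat.cast_sub (by omega : 1 ≤ K)]; ring
  have hKR : (2 : ℝ) ≤ K := by exact_mod_cast hK
  have e1 := cast_choose_pred (by omega : 1 ≤ K) t
  have e2 := cast_choose_pred (by omega : 1 ≤ K - 1) t
  rw [Nat.sub_sub, hK'] at e2
  rw [cacheSymbols, Nat.cast_sub (Nat.mul_le_mul (Nat.sub_le N 1) h3), Nat.cast_mul, Nat.cast_mul,
    Nat.cast_sub h1, Nat.cast_sub h2, Nat.cast_sub hN, e2, e1, Nat.cast_one]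
  have : (K : ℝ) ≠ 0 := by linarith
  have : (K : ℝ) - 1 ≠ 0 := by linarith
  field_simp
  ring

/-! ### The scheme -/

/-- The symbols of the files, extended by zero to labels of the wrong size. -/
def extendSymbols {N K : ℕ} {L : Type*} [Zero L] (t : ℕ)
    (W : Fin N → {S : Finset (Fin K) // S.card = t} → L) : Fin N × Finset (Fin K) → L :=
  fun p => if h : p.2.card = t then W p.1 ⟨p.2, h⟩ else 0

/-- The message and the cache of user `k` determine the requested file. -/
theorem eq_of_delivered_eq {N K t c : ℕ} {L : Type*} [Field L] {d : Fin K → Fin N}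
    {u : Fin N → Fin K} (hd : ∀ k, d (u (d k)) = d k) (k : Fin K)
    {Φ : (Fin N × Finset (Fin K) → L) →ₗ[L] (Fin c → L)}
    (hΦ : ∀ x ∈ hiddenSubmodule L t d u k, Φ x = 0 → x = 0)
    {W W' : Fin N → {S : Finset (Fin K) // S.card = t} → L}
    (hmessage : ∀ n S, S.card = t → u n ∉ S →
      delivered L d u n S (extendSymbols t W) = delivered L d u n S (extendSymbols t W'))
    (hcache : Φ (restrictTo L N k (extendSymbols t W)) =
      Φ (restrictTo L N k (extendSymbols t W'))) :
    W (d k) = W' (d k) := by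
  set x := extendSymbols t W - extendSymbols t W' with hx
  have hx0 : ∀ n S, S.card = t → u n ∉ S → delivered L d u n S x = 0 := fun n S hS hn => by
    rw [hx, map_sub, hmessage n S hS hn, sub_self]
  have hr : restrictTo L N k x = 0 := by
    refine hΦ _ ⟨fun p hp => ?_, fun n S h1 h2 h3 h4 => ?_⟩ ?_
    · rw [restrictTo_apply]
      split_ifs with hk
      · have hp' : p.2.card ≠ t := fun h => hp ⟨h, hk⟩
        simp [hx, extendSymbols, hp']
      · rfl
    · rw [delivered_restrictTo h1 h4, hx0 n S h2 h3]
    · rw [hx, map_sub, map_sub, hcache, sub_self]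
  funext ⟨S, hS⟩
  have := eq_zero_of_delivered_eq_zero hd k hx0 (fun n S _ hkS => by
    simpa [restrictTo_apply, hkS] using congrFun hr (n, S)) S hS
  simpa [hx, extendSymbols, hS, sub_eq_zero] using this

theorem card_slots {N K : ℕ} (t : ℕ) (u : Fin N → Fin K) :
    Fintype.card {p : Fin N × Finset (Fin K) // p.2.card = t ∧ u p.1 ∉ p.2} =
      N * (K - 1).choose t := by
  let e : {p : Fin N × Finset (Fin K) // p.2.card = t ∧ u p.1 ∉ p.2} ≃
      Σ n : Fin N, {S : Finset (Fin K) // S.card = t ∧ u n ∉ S} :=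
    { toFun := fun p => ⟨p.1.1, p.1.2, p.2⟩
      invFun := fun p => ⟨(p.1, p.2.1), p.2.2⟩
      left_inv := fun _ => rfl
      right_inv := fun _ => rfl }
  rw [Fintype.card_congr e, Fintype.card_sigma]
  have (n : Fin N) : Fintype.card {S : Finset (Fin K) // S.card = t ∧ u n ∉ S} =
      (K - 1).choose t := by
    rw [Fintype.card_subtype]
    simpa using card_filter_notMem t {u n}
  simp [this]

theorem exactlyAchievable_interferenceElimination {N K : ℕ} (hN : 1 ≤ N) (hNK : N ≤ K)
    (hK : 2 ≤ K) {t : ℕ} (ht : t ≤ K) :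
    ExactlyAchievable N K
      ((t : ℝ) * (((N : ℝ) - 1) * t + K - N) / ((K : ℝ) * ((K : ℝ) - 1)))
      ((N : ℝ) * ((K : ℝ) - t) / K) := by
  classical
  choose u hu hd using exists_leaders (K := K) hNK
  -- the field has more elements than there are pairs of a demand vector and a user
  set a := Fintype.card ((Fin K → Fin N) × Fin K) + 1 with ha
  let L := GaloisField 2 a
  have : Fintype L := Fintype.ofFinite L
  have hL : Fintype.card L = 2 ^ a := by
    rw [← Nat.card_eq_fintype_card, GaloisField.card 2 a (by omega)]
  obtain ⟨Φ, hΦ⟩ := exists_linearMap_injOn_submodules (L := L)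
    (ι := (Fin K → Fin N) × Fin K)
    (by rw [Nat.card_eq_fintype_card, hL]; exact (Nat.lt_succ_self _).trans Nat.lt_two_pow_self)
    (cacheSymbols N K t) (fun i => hiddenSubmodule L t i.1 (u i.1) i.2)
    (fun i => finrank_hiddenSubmodule_le t (hu i.1) i.2)
  refine ⟨a * K.choose t, Nat.mul_pos (by omega) (Nat.choose_pos ht), ?_⟩
  rintro _ ⟨l, rfl⟩
  have hfile : Fintype.card (Bits (a * K.choose t * l)) ≤
      Fintype.card (Fin l → {S : Finset (Fin K) // S.card = t} → L) := by
    simp [Bits, hL, pow_mul]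
  obtain ⟨file⟩ := Function.Embedding.nonempty_of_card_le hfile
  refine servesFileSize_of_determines (c := a * cacheSymbols N K t * l)
    (r := a * (N * (K - 1).choose t) * l) ?_ ?_ file file.injective
    (Y := Fin l → Fin (cacheSymbols N K t) → L)
    (Z := fun d => Fin l → {p : Fin N × Finset (Fin K) // p.2.card = t ∧ u d p.1 ∉ p.2} → L)
    (fun k W j => Φ (restrictTo L N k (extendSymbols t fun n => W n j)))
    (fun d W j p => delivered L d (u d) p.1.1 p.1.2 (extendSymbols t fun n => W n j))
    ?_ ?_ ?_
  · apply Nat.le_floor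
    push_cast
    rw [cast_cacheSymbols hN hK]
    apply le_of_eq
    ring
  · apply Nat.le_floor
    push_cast
    rw [cast_choose_pred (by omega)]
    apply le_of_eq
    ring
  · simp [hL, pow_mul]
  · intro d
    simp only [Fintype.card_fun, card_slots, hL, Fintype.card_fin, pow_mul, le_refl]
  · intro d k W W' hT hC
    funext j
    exact eq_of_delivered_eq (hd d) k (fun x hx => hΦ (d, k) x hx)
      (fun n S hS hn => congrFun (congrFun hT j) ⟨(n, S), hS, hn⟩) (congrFun hC j)

theorem theorem1 (N K : ℕ) (hN : 1 ≤ N) (hNK : N ≤ K) (hK : 2 ≤ K) (t : ℕ) (ht : t ≤ K) :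
    ExactlyAchievable N K
        ((t : ℝ) * (((N : ℝ) - 1) * t + K - N) / ((K : ℝ) * ((K : ℝ) - 1)))
        ((N : ℝ) * ((K : ℝ) - t) / K) ∧
      AsymptoticallyAchievable N K
        ((t : ℝ) * (((N : ℝ) - 1) * t + K - N) / ((K : ℝ) * ((K : ℝ) - 1)))
        ((N : ℝ) * ((K : ℝ) - t) / K) := by
  have hexact := exactlyAchievable_interferenceElimination hN hNK hK ht
  have hN' : (1 : ℝ) ≤ N := by exact_mod_cast hN
  have hNK' : (N : ℝ) ≤ K := by exact_mod_cast hNK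
  have hK' : (2 : ℝ) ≤ K := by exact_mod_cast hK
  have ht' : (t : ℝ) ≤ K := by exact_mod_cast ht
  have ht0 : (0 : ℝ) ≤ t := Nat.cast_nonneg t
  refine ⟨hexact, hexact.asymptoticallyAchievable ?_ ?_⟩
  · have := mul_nonneg (sub_nonneg.2 hN') ht0
    exact div_nonneg (mul_nonneg ht0 (by linarith)) (mul_nonneg (by linarith) (by linarith))
  · exact div_nonneg (mul_nonneg (by linarith) (by linarith)) (by linarith)
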